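/- **Setting.** Let $G$ be a locally compact (Hausdorff) group with identity $e$, and let $K\le G$ be a compact subgroup with normalised Haar measure $\omega$. Let $\mathcal C(G)$ be the space of continuous functions $G\to\mathbb C$ with the topology of uniform convergence on compact sets, and let $\mathcal M_c(G)$ be its dual, i.e. the space of compactly supported complex (Radon) Borel measures on $G$, with the weak* topology and the pairing $\langle\mu,f\rangle=\int f\,d\mu$. Convolution in $\mathcal M_c(G)$ is given by $\langle\mu*\nu,f\rangle=\int\!\int f(xy)\,d\nu(y)\,d\mu(x)$. For $f\in\mathcal C(G)$ put $f^{\#}(x)=\int_K\int_K f(kxl)\,d\omega(k)\,d\omega(l)$, and for $\mu\in\mathcal M_c(G)$ define $\mu^{\#}$ by $\langle\mu^{\#},f\rangle=\langle\mu,f^{\#}\rangle$. A function $f\in\mathcal C(G)$ is called $K$-invariant if $f(kxl)=f(x)$ for all $x\in G$ and $k,l\in K$. A measure $\mu$ is called $K$-invariant if $\langle \mu,f\rangle=\langle\mu,f^{\#}\rangle$ for all $f\in\mathcal C(G)$. The $K$-invariant measures form, under convolution and with the weak* topology, an algebra $\mathcal M_c(G//K)$ with unit $\delta_e^{\#}$,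 where $\delta_y$ denotes the point mass at $y$. The pair $(G,K)$ is called a *Gelfand pair* if this algebra is commutative. For $f\in \mathcal C(G)$ that is $K$-invariant and $y\in G$, the *modified $K$-spherical difference* is $D_{f;y}=\delta_{y^{-1}}^{\#}-f(y)\,\delta_e^{\#}\in\mathcal M_c(G//K)$. Let $M_f$ be the closure of the ideal of $\mathcal M_c(G//K)$ generated by all $D_{f;y}$, $y\in G$. **Theorem.** Let $(G,K)$ be a Gelfand pair and let $f\in\mathcal C(G)$ be $K$-invariant. The ideal $M_f$ is proper if and only if $f(e)=1$ and $$\int_K f(xky)\,d\omega(k)=f(x)f(y)\qquad\text{for all }x,y\in G .$$ In this case $M_f$ is a maximal ideal and $\mathcal M_c(G//K)/M_f\cong\mathbb C$ as complex algebras. Moreover there is such an isomorphism which is a homeomorphism for the quotient topology, that is, $M_f$ is an exponential maximal ideal. -/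

import Mathlib

open MeasureTheory

noncomputable section

set_option linter.unusedSectionVars false

namespace KSpherical

/-! ### Iterated pairings of functionals on spaces of continuous functions

All spaces `C(X, ℂ)` carry Mathlib's compact-open topology, which is the topology of uniform
convergence on compact sets. -/

section Pairing

variable {X Y : Type*} [TopologicalSpace X] [TopologicalSpace Y]

/-- The continuous function `x ↦ ψ (y ↦ F (x, y))`. -/
def pairing (ψ : C(Y, ℂ) →L[ℂ] ℂ) (F : C(X × Y, ℂ)) : C(X, ℂ) where
  toFun x := ψ (F.curry x)
  continuous_toFun := ψ.continuous.comp F.curry.continuous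

theorem pairing_apply (ψ : C(Y, ℂ) →L[ℂ] ℂ) (F : C(X × Y, ℂ)) (x : X) :
    pairing ψ F x = ψ (F.curry x) := rfl

/-- `pairing ψ` as a continuous linear map. -/
def pairingCLM [LocallyCompactSpace (X × Y)] (ψ : C(Y, ℂ) →L[ℂ] ℂ) :
    C(X × Y, ℂ) →L[ℂ] C(X, ℂ) where
  toFun F := pairing ψ F
  map_add' F H := by
    ext x
    exact map_add ψ (F.curry x) (H.curry x)
  map_smul' c F := by
    ext x
    exact map_smul ψ c (F.curry x)
  cont := (ContinuousMap.continuous_postcomp ⟨ψ, ψ.continuous⟩).comp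
    ContinuousMap.continuous_curry

/-- Precomposition with a continuous map, as a continuous linear map. -/
def precompCLM (g : C(X, Y)) : C(Y, ℂ) →L[ℂ] C(X, ℂ) where
  toFun f := f.comp g
  map_add' _ _ := rfl
  map_smul' _ _ := rfl
  cont := ContinuousMap.continuous_precomp g

/-- A continuous functional on `C(X, ℂ)` is controlled by a compact set. -/
theorem exists_compact_bound (D : C(X, ℂ) →L[ℂ] ℂ) :
    ∃ C : Set X, IsCompact C ∧ ∃ ε : ℝ, 0 < ε ∧
      ∀ F : C(X, ℂ), (∀ x ∈ C, ‖F x‖ < ε) → ‖D F‖ < 1 := by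
  have h : D ⁻¹' Metric.ball 0 1 ∈ nhds (0 : C(X, ℂ)) := by
    apply D.continuous.continuousAt
    rw [map_zero]
    exact Metric.ball_mem_nhds _ one_pos
  have hb := nhds_basis_uniformity' (x := (0 : C(X, ℂ)))
    (Metric.uniformity_basis_dist.compactConvergenceUniformity (α := X) (β := ℂ))
  obtain ⟨⟨C, ε⟩, ⟨hC, hε⟩, hsub⟩ := hb.mem_iff.1 h
  refine ⟨C, hC, ε, hε, fun F hF => ?_⟩
  have : F ∈ D ⁻¹' Metric.ball 0 1 := by
    apply hsub
    intro x hx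
    simpa [dist_eq_norm] using hF x hx
  simpa using this

/-- The complexification of a real continuous function. -/
def toComplex : C(X, ℝ) →ₗ[ℝ] C(X, ℂ) where
  toFun u := ⟨fun x => (u x : ℂ), by fun_prop⟩
  map_add' u v := by
    ext x
    simp
  map_smul' c u := by
    ext x
    simp

theorem toComplex_apply (u : C(X, ℝ)) (x : X) : toComplex u x = (u x : ℂ) := rfl

/-- A continuous functional on `C(X × Y, ℂ)` that vanishes on all products of real functions of
one variable is zero. -/
theorem eq_zero_of_products [LocallyCompactSpace X] [LocallyCompactSpace Y] [T2Space X]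
    [T2Space Y] (D : C(X × Y, ℂ) →L[ℂ] ℂ)
    (hD : ∀ (g : C(X, ℝ)) (h : C(Y, ℝ)),
      D (toComplex (g.comp ContinuousMap.fst * h.comp ContinuousMap.snd)) = 0)
    (F : C(X × Y, ℂ)) : D F = 0 := by
  let S : Submonoid C(X × Y, ℝ) :=
    { carrier := {p | ∃ (g : C(X, ℝ)) (h : C(Y, ℝ)),
        p = g.comp ContinuousMap.fst * h.comp ContinuousMap.snd}
      one_mem' := ⟨1, 1, by ext; simp⟩
      mul_mem' := by
        rintro _ _ ⟨g, h, rfl⟩ ⟨g', h', rfl⟩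
        refine ⟨g * g', h * h', ?_⟩
        ext z
        simp only [ContinuousMap.mul_apply, ContinuousMap.comp_apply]
        ring }
  have hA0 : ∀ p ∈ Algebra.adjoin ℝ (S : Set C(X × Y, ℝ)), D (toComplex p) = 0 := by
    intro p hp
    rw [← Subalgebra.mem_toSubmodule, Algebra.adjoin_eq_span, Submonoid.closure_eq] at hp
    induction hp using Submodule.span_induction with
    | mem p hp =>
      obtain ⟨g, h, rfl⟩ := hp
      exact hD g h
    | zero => simp
    | add p q _ _ hp hq => rw [map_add, map_add, hp, hq, add_zero]
    | smul c p _ hp =>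
      have : toComplex (c • p) = (c : ℂ) • toComplex p := by
        ext z
        simp [toComplex_apply]
      rw [this, map_smul, hp, smul_zero]
  have hsep : (Algebra.adjoin ℝ (S : Set C(X × Y, ℝ))).SeparatesPoints := by
    intro z w hzw
    have hp : ∀ (g : C(X, ℝ)) (h : C(Y, ℝ)), g.comp ContinuousMap.fst *
        h.comp ContinuousMap.snd ∈ Algebra.adjoin ℝ (S : Set C(X × Y, ℝ)) :=
      fun g h => Algebra.subset_adjoin ⟨g, h, rfl⟩
    by_cases h1 : z.1 = w.1
    · have h2 : z.2 ≠ w.2 := fun h2 => hzw (Prod.ext h1 h2)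
      obtain ⟨f, hf0, hf1, -⟩ := exists_continuous_zero_one_of_isCompact
        (isCompact_singleton (x := z.2)) (isClosed_singleton (x := w.2)) (by simpa using h2)
      refine ⟨_, ⟨_, hp 1 f, rfl⟩, ?_⟩
      have e0 := hf0 rfl
      have e1 := hf1 rfl
      simp only [Pi.one_apply, Pi.zero_apply] at e0 e1
      simp [e0, e1]
    · obtain ⟨f, hf0, hf1, -⟩ := exists_continuous_zero_one_of_isCompact
        (isCompact_singleton (x := z.1)) (isClosed_singleton (x := w.1)) (by simpa using h1)
      refine ⟨_, ⟨_, hp f 1, rfl⟩, ?_⟩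
      have e0 := hf0 rfl
      have e1 := hf1 rfl
      simp only [Pi.one_apply, Pi.zero_apply] at e0 e1
      simp [e0, e1]
  obtain ⟨C, hC, ε, hε, hbd⟩ := exists_compact_bound D
  have hreal : ∀ u : C(X × Y, ℝ), D (toComplex u) = 0 := by
    intro u
    by_contra hne
    have key : ∀ t : ℝ, ‖D (toComplex (t • u))‖ < 1 := by
      intro t
      obtain ⟨p, hp, hpu⟩ :=
        ContinuousMap.exists_mem_subalgebra_near_continuous_of_isCompact_of_separatesPoints
          hsep (t • u) hC hε
      have h1 : D (toComplex (t • u)) = D (toComplex (t • u - p)) := by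
        rw [map_sub, map_sub, hA0 p hp, sub_zero]
      rw [h1]
      apply hbd
      intro z hz
      rw [toComplex_apply, Complex.norm_real, ContinuousMap.sub_apply, norm_sub_rev]
      exact hpu z hz
    have hpos : 0 < ‖D (toComplex u)‖ := norm_pos_iff.2 hne
    have := key (‖D (toComplex u)‖⁻¹)
    have h2 : toComplex (‖D (toComplex u)‖⁻¹ • u) =
        ((‖D (toComplex u)‖⁻¹ : ℝ) : ℂ) • toComplex u := by
      ext z
      simp [toComplex_apply]
    rw [h2, map_smul, norm_smul, Complex.norm_real, norm_inv, norm_norm,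
      inv_mul_cancel₀ hpos.ne'] at this
    exact lt_irrefl _ this
  have hF : F = toComplex ⟨fun z => (F z).re, by fun_prop⟩ +
      Complex.I • toComplex ⟨fun z => (F z).im, by fun_prop⟩ := by
    ext z
    simp only [ContinuousMap.add_apply, ContinuousMap.smul_apply, toComplex_apply,
      ContinuousMap.coe_mk, smul_eq_mul]
    rw [mul_comm, Complex.re_add_im]
  rw [hF, map_add, map_smul, hreal, hreal, smul_zero, add_zero]

/-- Fubini's theorem for continuous functionals. -/
theorem pairing_swap [LocallyCompactSpace X] [LocallyCompactSpace Y] [T2Space X] [T2Space Y]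
    (φ : C(X, ℂ) →L[ℂ] ℂ) (ψ : C(Y, ℂ) →L[ℂ] ℂ) (F : C(X × Y, ℂ)) :
    φ (pairing ψ F) = ψ (pairing φ (F.comp ⟨Prod.swap, continuous_swap⟩)) := by
  have h := eq_zero_of_products
    (φ.comp (pairingCLM ψ) - (ψ.comp (pairingCLM φ)).comp
      (precompCLM (⟨Prod.swap, continuous_swap⟩ : C(Y × X, X × Y)))) ?_ F
  · exact sub_eq_zero.1 h
  · intro g h
    have h1 : pairing ψ (toComplex (g.comp ContinuousMap.fst * h.comp ContinuousMap.snd)) =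
        ψ (toComplex h) • toComplex g := by
      ext x
      have : (toComplex (g.comp ContinuousMap.fst * h.comp ContinuousMap.snd)).curry x =
          (g x : ℂ) • toComplex h := by
        ext y
        simp [toComplex_apply]
      rw [pairing_apply, this, map_smul]
      simp [toComplex_apply, mul_comm]
    have h2 : pairing φ ((toComplex (g.comp ContinuousMap.fst *
        h.comp ContinuousMap.snd)).comp ⟨Prod.swap, continuous_swap⟩) =
        φ (toComplex g) • toComplex h := by
      ext y
      have : ((toComplex (g.comp ContinuousMap.fst * h.comp ContinuousMap.snd)).comp
          (⟨Prod.swap, continuous_swap⟩ : C(Y × X, X × Y))).curry y =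
          (h y : ℂ) • toComplex g := by
        ext x
        simp [toComplex_apply, mul_comm]
      rw [pairing_apply, this, map_smul]
      simp [toComplex_apply, mul_comm]
    change φ (pairing ψ _) - ψ (pairing φ (ContinuousMap.comp _ _)) = 0
    rw [h1, h2, map_smul, map_smul, smul_eq_mul, smul_eq_mul, mul_comm, sub_self]

end Pairing

/-! ### Compactly supported measures and their convolution -/

section Group

variable {G : Type*} [TopologicalSpace G]

/-- The space `M_c(G)` of compactly supported complex (Radon) Borel measures on `G`, as the dual
of `C(G)` with its weak* topology; the value `μ f` is the pairing `⟨μ, f⟩ = ∫ f dμ`. -/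
abbrev CompactMeasure (G : Type*) [TopologicalSpace G] : Type _ := WeakDual ℂ C(G, ℂ)

/-- The point mass `δ_y`. -/
def pointMass (y : G) : CompactMeasure G :=
  StrongDual.toWeakDual (ContinuousMap.evalCLM ℂ y)

theorem pointMass_apply (y : G) (f : C(G, ℂ)) : pointMass y f = f y := rfl

variable [Group G] [IsTopologicalGroup G]

/-- The function `(x, y) ↦ f (x * y)`. -/
def mulPull (f : C(G, ℂ)) : C(G × G, ℂ) := f.comp ⟨fun p => p.1 * p.2, continuous_mul⟩

/-- The function `y ↦ f (x * y)`. -/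
def translate (f : C(G, ℂ)) (x : G) : C(G, ℂ) := f.comp ⟨fun y => x * y, continuous_const_mul x⟩

theorem translate_apply (f : C(G, ℂ)) (x y : G) : translate f x y = f (x * y) := rfl

/-- Convolution: `⟨μ * ν, f⟩ = ∫ (∫ f (x * y) dν(y)) dμ(x)`. -/
def conv [LocallyCompactSpace G] (μ ν : CompactMeasure G) : CompactMeasure G :=
  StrongDual.toWeakDual <|
    (WeakDual.toStrongDual μ).comp <| (pairingCLM (WeakDual.toStrongDual ν)).comp <|
      precompCLM (⟨fun p => p.1 * p.2, continuous_mul⟩ : C(G × G, G))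

/-- The function `x ↦ ∫ f (x * y) dν(y)`. -/
def convInner (ν : CompactMeasure G) (f : C(G, ℂ)) : C(G, ℂ) :=
  pairing (WeakDual.toStrongDual ν) (mulPull f)

theorem convInner_apply (ν : CompactMeasure G) (f : C(G, ℂ)) (x : G) :
    convInner ν f x = ν (translate f x) := rfl

theorem conv_apply [LocallyCompactSpace G] (μ ν : CompactMeasure G) (f : C(G, ℂ)) :
    conv μ ν f = μ (convInner ν f) := rfl

theorem conv_assoc [LocallyCompactSpace G] (μ ν ρ : CompactMeasure G) :
    conv (conv μ ν) ρ = conv μ (conv ν ρ) := by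
  apply DFunLike.ext
  intro f
  change μ (convInner ν (convInner ρ f)) = μ (convInner (conv ν ρ) f)
  congr 1
  ext x
  change ν (translate (convInner ρ f) x) = ν (convInner ρ (translate f x))
  congr 1
  ext y
  change ρ (translate f (x * y)) = ρ (translate (translate f x) y)
  congr 1
  ext z
  simp [translate_apply, mul_assoc]

/-! ### Averaging over the compact subgroup -/

variable (K : Subgroup G) [CompactSpace K] [MeasurableSpace G] [BorelSpace G]

/-- The normalised Haar measure on `K`. -/
def haarK : Measure K := Measure.haarMeasure ⊤

instance : IsProbabilityMeasure (haarK K) :=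
  ⟨Measure.haarMeasure_self (K₀ := (⊤ : TopologicalSpace.PositiveCompacts K))⟩

instance : (haarK K).IsHaarMeasure := Measure.isHaarMeasure_haarMeasure _

/-- Integration over `K` as a continuous functional. -/
def integralK : C(K, ℂ) →L[ℂ] ℂ :=
  LinearMap.mkContinuous
    { toFun := fun f => ∫ k, f k ∂haarK K
      map_add' := fun f g => integral_add
        (f.continuous.integrable_of_hasCompactSupport (HasCompactSupport.of_compactSpace _))
        (g.continuous.integrable_of_hasCompactSupport (HasCompactSupport.of_compactSpace _))
      map_smul' := fun c f => integral_const_mul c _ } 1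
    (fun f => by
      have := norm_integral_le_of_norm_le_const (μ := haarK K) (f := f) (C := ‖f‖)
        (Filter.Eventually.of_forall fun k => f.norm_coe_le_norm k)
      simpa using this)

theorem integralK_apply (f : C(K, ℂ)) : integralK K f = ∫ k, f k ∂haarK K := rfl

/-- The function `x ↦ ∫ f (k * x) dω(k)`. -/
def leftAvg (f : C(G, ℂ)) : C(G, ℂ) :=
  pairing (integralK K) (f.comp ⟨fun p : G × K => p.2 * p.1, by fun_prop⟩)

/-- The function `x ↦ ∫ f (x * l) dω(l)`. -/
def rightAvg (f : C(G, ℂ)) : C(G, ℂ) :=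
  pairing (integralK K) (f.comp ⟨fun p : G × K => p.1 * p.2, by fun_prop⟩)

theorem leftAvg_apply (f : C(G, ℂ)) (x : G) :
    leftAvg K f x = ∫ k : K, f (k * x) ∂haarK K := rfl

theorem rightAvg_apply (f : C(G, ℂ)) (x : G) :
    rightAvg K f x = ∫ l : K, f (x * l) ∂haarK K := rfl

/-- The projection `f^#`. -/
def sharp (f : C(G, ℂ)) : C(G, ℂ) where
  toFun x := ∫ l : K, ∫ k : K, f (k * x * l) ∂haarK K ∂haarK K
  continuous_toFun := by
    have : (fun x : G => ∫ l : K, ∫ k : K, f (k * x * l) ∂haarK K ∂haarK K) =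
        rightAvg K (leftAvg K f) := by
      ext x
      simp [leftAvg_apply, rightAvg_apply, mul_assoc]
    rw [this]
    exact ContinuousMap.continuous _

theorem sharp_apply (f : C(G, ℂ)) (x : G) :
    sharp K f x = ∫ l : K, ∫ k : K, f (k * x * l) ∂haarK K ∂haarK K := rfl

theorem sharp_eq (f : C(G, ℂ)) : sharp K f = rightAvg K (leftAvg K f) := by
  ext x
  simp [leftAvg_apply, rightAvg_apply, sharp_apply, mul_assoc]

variable [LocallyCompactSpace G] [T2Space G]

/-- The projection as a continuous linear map. -/
def sharpCLM : C(G, ℂ) →L[ℂ] C(G, ℂ) where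
  toFun f := sharp K f
  map_add' f g := by
    simp only [sharp_eq]
    exact map_add ((((pairingCLM (integralK K)).comp (precompCLM
      (⟨fun p => p.1 * p.2, by fun_prop⟩ : C(G × K, G)))).comp (pairingCLM (integralK K))).comp
      (precompCLM (⟨fun p => p.2 * p.1, by fun_prop⟩ : C(G × K, G)))) f g
  map_smul' c f := by
    simp only [sharp_eq]
    exact map_smul ((((pairingCLM (integralK K)).comp (precompCLM
      (⟨fun p => p.1 * p.2, by fun_prop⟩ : C(G × K, G)))).comp (pairingCLM (integralK K))).comp
      (precompCLM (⟨fun p => p.2 * p.1, by fun_prop⟩ : C(G × K, G)))) c f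
  cont := by
    simp only [sharp_eq]
    exact ((((pairingCLM (integralK K)).comp (precompCLM
      (⟨fun p => p.1 * p.2, by fun_prop⟩ : C(G × K, G)))).comp (pairingCLM (integralK K))).comp
      (precompCLM (⟨fun p => p.2 * p.1, by fun_prop⟩ : C(G × K, G)))).continuous

theorem fubiniK (F : C(K × K, ℂ)) :
    ∫ k, ∫ l, F (k, l) ∂haarK K ∂haarK K = ∫ l, ∫ k, F (k, l) ∂haarK K ∂haarK K :=
  pairing_swap (integralK K) (integralK K) F

theorem leftAvg_rightAvg (f : C(G, ℂ)) :
    leftAvg K (rightAvg K f) = rightAvg K (leftAvg K f) := by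
  ext x
  simp only [leftAvg_apply, rightAvg_apply]
  have := fubiniK K (f.comp ⟨fun p => p.1 * x * p.2, by fun_prop⟩)
  simpa [mul_assoc] using this

theorem leftAvg_leftAvg (f : C(G, ℂ)) : leftAvg K (leftAvg K f) = leftAvg K f := by
  ext x
  simp only [leftAvg_apply]
  have h := fubiniK K (f.comp ⟨fun p => p.2 * (p.1 * x), by fun_prop⟩)
  simp only [ContinuousMap.comp_apply, ContinuousMap.coe_mk] at h
  rw [h]
  have h2 : ∀ l : K, ∫ k : K, f (l * (k * x)) ∂haarK K = ∫ k : K, f (k * x) ∂haarK K := by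
    intro l
    have := integral_mul_left_eq_self (μ := haarK K) (fun k : K => f (k * x)) l
    simpa [mul_assoc] using this
  simp [h2]

theorem rightAvg_rightAvg (f : C(G, ℂ)) : rightAvg K (rightAvg K f) = rightAvg K f := by
  ext x
  simp only [rightAvg_apply]
  have h2 : ∀ l : K, ∫ k : K, f (x * l * k) ∂haarK K = ∫ k : K, f (x * k) ∂haarK K := by
    intro l
    have := integral_mul_left_eq_self (μ := haarK K) (fun k : K => f (x * k)) l
    simpa [mul_assoc] using this
  simp [h2]

/-! ### The algebra of `K`-invariant measures -/

/-- `f` is bi-`K`-invariant. -/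
def IsKInvariant (f : C(G, ℂ)) : Prop :=
  ∀ (k l : K) (x : G), f (k * x * l) = f x

/-- The space `M_c(G//K)` of `K`-invariant measures: those `μ` in `M_c(G)` with
`⟨μ, f⟩ = ⟨μ, f^#⟩` for all `f` in `C(G)`. -/
@[ext]
structure KMeasure where
  val : CompactMeasure G
  invariant : ∀ f : C(G, ℂ), val f = val (sharp K f)

variable {K}

theorem KMeasure.val_injective :
    Function.Injective (KMeasure.val : KMeasure K → CompactMeasure G) :=
  fun _ _ h => KMeasure.ext h

instance : Zero (KMeasure K) := ⟨⟨0, fun _ => rfl⟩⟩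

instance : Add (KMeasure K) :=
  ⟨fun μ ν => ⟨μ.val + ν.val, fun f => congrArg₂ (· + ·) (μ.invariant f) (ν.invariant f)⟩⟩

instance : Neg (KMeasure K) :=
  ⟨fun μ => ⟨-μ.val, fun f => congrArg (-·) (μ.invariant f)⟩⟩

instance : Sub (KMeasure K) :=
  ⟨fun μ ν => ⟨μ.val - ν.val, fun f => congrArg₂ (· - ·) (μ.invariant f) (ν.invariant f)⟩⟩

instance : SMul ℂ (KMeasure K) :=
  ⟨fun c μ => ⟨c • μ.val, fun f => congrArg (c • ·) (μ.invariant f)⟩⟩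

instance : SMul ℕ (KMeasure K) :=
  ⟨fun n μ => ⟨n • μ.val, fun f => congrArg (n • ·) (μ.invariant f)⟩⟩

instance : SMul ℤ (KMeasure K) :=
  ⟨fun n μ => ⟨n • μ.val, fun f => congrArg (n • ·) (μ.invariant f)⟩⟩

instance : AddCommGroup (KMeasure K) :=
  Function.Injective.addCommGroup KMeasure.val KMeasure.val_injective rfl (fun _ _ => rfl)
    (fun _ => rfl) (fun _ _ => rfl) (fun _ _ => rfl) (fun _ _ => rfl)

theorem KMeasure.zero_val : (0 : KMeasure K).val = 0 := rfl

theorem KMeasure.add_val (μ ν : KMeasure K) : (μ + ν).val = μ.val + ν.val := rfl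

theorem KMeasure.neg_val (μ : KMeasure K) : (-μ).val = -μ.val := rfl

theorem KMeasure.sub_val (μ ν : KMeasure K) : (μ - ν).val = μ.val - ν.val := rfl

theorem KMeasure.smul_val (c : ℂ) (μ : KMeasure K) : (c • μ).val = c • μ.val := rfl

instance : Module ℂ (KMeasure K) :=
  Function.Injective.module ℂ (⟨⟨KMeasure.val, rfl⟩, fun _ _ => rfl⟩ : KMeasure K →+ _)
    KMeasure.val_injective (fun _ _ => rfl)

/-- `M_c(G//K)` carries the weak* topology inherited from `M_c(G)`. -/
instance : TopologicalSpace (KMeasure K) := TopologicalSpace.induced KMeasure.val inferInstance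

theorem KMeasure.continuous_val : Continuous (KMeasure.val : KMeasure K → CompactMeasure G) :=
  continuous_induced_dom

instance : ContinuousAdd (KMeasure K) :=
  ⟨continuous_induced_rng.2 ((KMeasure.continuous_val.comp continuous_fst).add
    (KMeasure.continuous_val.comp continuous_snd))⟩

theorem KMeasure.sharp_eq (μ : KMeasure K) (f : C(G, ℂ)) : μ.1 (sharp K f) = μ.1 f :=
  (μ.2 f).symm

theorem KMeasure.leftAvg_eq (μ : KMeasure K) (f : C(G, ℂ)) : μ.1 (leftAvg K f) = μ.1 f := by
  rw [← μ.sharp_eq, KSpherical.sharp_eq, leftAvg_leftAvg, ← KSpherical.sharp_eq, μ.sharp_eq]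

theorem KMeasure.rightAvg_eq (μ : KMeasure K) (f : C(G, ℂ)) : μ.1 (rightAvg K f) = μ.1 f := by
  rw [← μ.sharp_eq, KSpherical.sharp_eq, leftAvg_rightAvg, rightAvg_rightAvg,
    ← KSpherical.sharp_eq, μ.sharp_eq]

theorem convInner_rightAvg (ν : KMeasure K) (f : C(G, ℂ)) :
    convInner ν.1 (rightAvg K f) = convInner ν.1 f := by
  ext x
  rw [convInner_apply, convInner_apply, ← ν.rightAvg_eq (translate f x)]
  congr 1
  ext y
  simp [translate_apply, rightAvg_apply, mul_assoc]

theorem convInner_leftAvg (ν : CompactMeasure G) (f : C(G, ℂ)) :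
    convInner ν (leftAvg K f) = leftAvg K (convInner ν f) := by
  ext x
  have h := pairing_swap (integralK K) (WeakDual.toStrongDual ν)
    (f.comp ⟨fun p : K × G => p.1 * (x * p.2), by fun_prop⟩)
  refine Eq.trans ?_ (h.symm.trans ?_)
  · rfl
  · rw [leftAvg_apply, integralK_apply]
    refine integral_congr_ae (Filter.Eventually.of_forall fun k => ?_)
    change ν _ = ν (translate f (k * x))
    congr 1
    ext y
    change f (k * (x * y)) = f (k * x * y)
    rw [mul_assoc]

theorem conv_invariant (μ ν : KMeasure K) (f : C(G, ℂ)) :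
    conv μ.1 ν.1 f = conv μ.1 ν.1 (sharp K f) := by
  rw [conv_apply, conv_apply, KSpherical.sharp_eq, convInner_rightAvg, convInner_leftAvg, μ.leftAvg_eq]

variable (K)

/-- The projection `μ^#`, given by `⟨μ^#, f⟩ = ⟨μ, f^#⟩`. -/
def project (μ : CompactMeasure G) : KMeasure K :=
  ⟨StrongDual.toWeakDual ((WeakDual.toStrongDual μ).comp (sharpCLM K)), fun f => by
    change μ (sharp K f) = μ (sharp K (sharp K f))
    congr 1
    rw [sharp_eq K (sharp K f), sharp_eq, leftAvg_rightAvg, leftAvg_leftAvg, rightAvg_rightAvg]⟩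

theorem project_apply (μ : CompactMeasure G) (f : C(G, ℂ)) :
    (project K μ).1 f = μ (sharp K f) := rfl

variable {K}

theorem rightAvg_one (f : C(G, ℂ)) : rightAvg K f 1 = leftAvg K f 1 := by
  simp [rightAvg_apply, leftAvg_apply]

theorem sharp_one (f : C(G, ℂ)) : sharp K f 1 = leftAvg K f 1 := by
  rw [sharp_eq, rightAvg_one, leftAvg_leftAvg]

/-- `M_c(G//K)` is a ring under convolution; its unit is the projection of `δ_e`. -/
instance : Ring (KMeasure K) :=
  { (inferInstance : AddCommGroup (KMeasure K)) with
    mul := fun μ ν => ⟨conv μ.1 ν.1, conv_invariant μ ν⟩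
    one := project K (pointMass 1)
    mul_assoc := fun μ ν ρ => KMeasure.ext (conv_assoc μ.1 ν.1 ρ.1)
    left_distrib := fun μ ν ρ => by
      apply KMeasure.ext
      apply DFunLike.ext
      intro f
      exact map_add μ.1 (convInner ν.1 f) (convInner ρ.1 f)
    right_distrib := fun _ _ _ => rfl
    zero_mul := fun _ => rfl
    mul_zero := fun μ => by
      apply KMeasure.ext
      apply DFunLike.ext
      intro f
      exact map_zero μ.1
    one_mul := fun μ => by
      apply KMeasure.ext
      apply DFunLike.ext
      intro f
      change sharp K (convInner μ.1 f) 1 = μ.1 f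
      rw [sharp_one, ← convInner_leftAvg, convInner_apply, ← μ.leftAvg_eq f]
      congr 1
      ext y
      simp [translate_apply]
    mul_one := fun μ => by
      apply KMeasure.ext
      apply DFunLike.ext
      intro f
      change μ.1 (convInner (project K (pointMass 1)).1 f) = μ.1 f
      rw [← μ.rightAvg_eq f]
      congr 1
      ext x
      rw [convInner_apply, project_apply, pointMass_apply, sharp_one, leftAvg_apply, rightAvg_apply]
      simp [translate_apply] }

theorem KMeasure.coe_mul (μ ν : KMeasure K) : (μ * ν).1 = conv μ.1 ν.1 := rfl

theorem KMeasure.one_def : (1 : KMeasure K) = project K (pointMass 1) := rfl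

instance : Algebra ℂ (KMeasure K) :=
  Algebra.ofModule (fun _ _ _ => rfl) (fun c μ ν => by
    apply KMeasure.ext
    apply DFunLike.ext
    intro f
    exact map_smul μ.1 c (convInner ν.1 f))

variable (K)

/-- `(G, K)` is a Gelfand pair: convolution in `M_c(G//K)` is commutative. -/
class IsGelfandPair : Prop where
  mul_comm : ∀ μ ν : KMeasure K, μ * ν = ν * μ

variable {K}

instance [IsGelfandPair K] : CommRing (KMeasure K) :=
  { (inferInstance : Ring (KMeasure K)) with mul_comm := IsGelfandPair.mul_comm }

instance [IsGelfandPair K] : ContinuousConstSMul (KMeasure K) (KMeasure K) where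
  continuous_const_smul μ := by
    have : (fun ν : KMeasure K => μ • ν) = fun ν => ν * μ := by
      ext1 ν
      exact IsGelfandPair.mul_comm μ ν
    rw [this]
    refine continuous_induced_rng.2 (WeakDual.continuous_of_continuous_eval fun f => ?_)
    exact (WeakDual.eval_continuous (convInner μ.1 f)).comp KMeasure.continuous_val

variable (K)

/-- The modified `K`-spherical difference `D_{f;y} = δ_{y⁻¹}^# - f(y) δ_e`, where `δ_e` as an
element of `M_c(G//K)` is its unit `δ_e^#`. -/
def sphericalDifference (f : C(G, ℂ)) (y : G) : KMeasure K :=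
  project K (pointMass y⁻¹) - f y • project K (pointMass 1)

/-- The ideal `M_f`: the closure of the ideal generated by all modified `K`-spherical
differences. -/
def sphericalIdeal [IsGelfandPair K] (f : C(G, ℂ)) : Ideal (KMeasure K) :=
  (Ideal.span (Set.range (sphericalDifference K f))).topologicalClosure

variable {K}

/-- An exponential maximal ideal: a maximal ideal whose residue algebra is topologically
isomorphic to `ℂ`. -/
structure IsExponentialMaximal [IsGelfandPair K] (I : Ideal (KMeasure K)) : Prop where
  isMaximal : I.IsMaximal
  exists_equiv : ∃ e : (KMeasure K ⧸ I) ≃ₐ[ℂ] ℂ, Continuous e ∧ Continuous e.symm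

end Group

end KSpherical

end

/-!
Write `f̌ x = f x⁻¹`. Everything rests on the fact that the `K`-averaged functions annihilating
the closed ideal `M_f` are multiples of `f̌`. Suppose that `g = g^#` pairs to zero with `M_f`.
Pairing `g` with `μ * D_{f;y}`, which lies in `M_f`, gives `⟨μ * δ_{y⁻¹}^#, g⟩ = f y * ⟨μ, g⟩` for every
`K`-invariant `μ` (`mul_project_apply_of_annihilates`); with `μ = δ_e^#` this reads `g = g(e) f̌`
(`eq_smul_reflect_of_annihilates`). Such functions are plentiful: by the Hahn–Banach theorem for
the weak* topology, whose continuous functionals are pairings with continuous functions, any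
measure outside a closed ideal is separated from it by some `g = g^#` (`exists_separating_sharp`).

If `M_f` is proper, separate the unit from it: then `g(e) ≠ 0`, and the identity above with
`μ = δ_e^#` and `μ = δ_{y⁻¹}^#` yields `f(e) = 1` and, as Haar measure on `K` is invariant under
inversion, the functional equation of `f` (`spherical_of_sphericalIdeal_ne_top`).

Conversely, if `f` satisfies the functional equation, then so does `f̌`, and `χ μ = ⟨μ, f̌⟩` is a
continuous character of `M_c(G//K)` that kills all `D_{f;y}`, so that `M_f ⊆ ker χ`. A measure
outside `M_f` is separated from `M_f` by a multiple of `f̌`, hence does not lie in `ker χ`. So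
`M_f = ker χ` (`sphericalIdeal_eq_ker`), and the kernel of a continuous character is an exponential
maximal ideal (`isExponentialMaximal_ker`).
-/

open MeasureTheory

noncomputable section

namespace KSpherical

/-! ### Separation in the weak* topology -/

section Separation

/-- Hahn–Banach for a weak topology `σ(E, F)`: every continuous functional is the pairing with an
element of `F`, so a point outside a closed subspace is separated from it by such an element. -/
theorem exists_separating_of_isInducing {E F : Type*} [AddCommGroup E] [Module ℂ E]
    [t : TopologicalSpace E] [AddCommGroup F] [Module ℂ F] (B : E →ₗ[ℂ] F →ₗ[ℂ] ℂ)
    (hB : Topology.IsInducing fun x y => B x y) (M : Submodule ℂ E)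
    (hM : IsClosed (M : Set E)) {x : E} (hx : x ∉ M) :
    ∃ g : F, (∀ y ∈ M, B y g = 0) ∧ B x g ≠ 0 := by
  obtain rfl : t = WeakBilin.instTopologicalSpace B := hB.eq_induced
  let : Module ℝ E := Module.complexToReal E
  have := IsScalarTower.continuousSMul (M := ℝ) (α := WeakBilin B) ℂ
  have hM' : IsClosed (X := WeakBilin B) (M : Set E) := hM
  obtain ⟨φ, u, hlt, hu⟩ := RCLike.geometric_hahn_banach_closed_point (𝕜 := ℂ) (E := WeakBilin B)
    (M.restrictScalars ℝ).convex hM' hx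
  obtain ⟨g, rfl⟩ := LinearMap.dualEmbedding_surjective B φ
  have hlt' : ∀ y ∈ M, (B y g).re < u := hlt
  have hu0 : 0 < u := by simpa using hlt' 0 M.zero_mem
  refine ⟨g, fun y hy => ?_, fun h => hu0.not_gt (hu.trans_eq (congrArg Complex.re h))⟩
  by_contra hne
  -- a functional whose real part is bounded above on a subspace vanishes there: rescale `y`
  have := hlt' (((u : ℂ) / B y g) • y) (M.smul_mem _ hy)
  rw [map_smul, LinearMap.smul_apply, smul_eq_mul, div_mul_cancel₀ _ hne,
    Complex.ofReal_re] at this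
  exact lt_irrefl _ this

end Separation

/-! ### Reflection and averages of functions -/

section Functions

variable {G : Type*} [Group G] [TopologicalSpace G] [IsTopologicalGroup G] {K : Subgroup G}

/-- The reflected function `x ↦ f x⁻¹`. -/
def reflect (f : C(G, ℂ)) : C(G, ℂ) := f.comp ⟨fun x => x⁻¹, continuous_inv⟩

theorem reflect_apply (f : C(G, ℂ)) (x : G) : reflect f x = f x⁻¹ := rfl

theorem IsKInvariant.reflect {f : C(G, ℂ)} (hf : IsKInvariant K f) :
    IsKInvariant K (reflect f) := by
  intro k l x
  simpa [reflect_apply, mul_assoc] using hf l⁻¹ k⁻¹ x⁻¹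

variable [CompactSpace K] [MeasurableSpace G] [BorelSpace G]

theorem IsKInvariant.sharp_eq {f : C(G, ℂ)} (hf : IsKInvariant K f) : sharp K f = f := by
  ext x
  simp [sharp_apply, hf _ _ x]

theorem leftAvg_translate_apply (g : C(G, ℂ)) (x y : G) :
    leftAvg K (translate g x) y = ∫ k : K, g (x * k * y) ∂haarK K := by
  simp [leftAvg_apply, translate_apply, mul_assoc]

end Functions

/-! ### Separation by averaged functions -/

section Spherical

variable {G : Type*} [Group G] [TopologicalSpace G] [IsTopologicalGroup G]
  [LocallyCompactSpace G] [T2Space G] [MeasurableSpace G] [BorelSpace G]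
  {K : Subgroup G} [CompactSpace K]

/-- The pairing between invariant measures and continuous functions. -/
def dualPairing (K : Subgroup G) [CompactSpace K] : KMeasure K →ₗ[ℂ] C(G, ℂ) →ₗ[ℂ] ℂ where
  toFun μ := (WeakDual.toStrongDual μ.1).toLinearMap
  map_add' _ _ := rfl
  map_smul' _ _ := rfl

theorem isInducing_dualPairing :
    Topology.IsInducing fun (μ : KMeasure K) (g : C(G, ℂ)) => dualPairing K μ g :=
  Topology.IsInducing.comp (g := fun (μ : CompactMeasure G) (g : C(G, ℂ)) => μ g) ⟨rfl⟩ ⟨rfl⟩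

theorem continuous_dualPairing_flip (g : C(G, ℂ)) : Continuous ((dualPairing K).flip g) :=
  (WeakDual.eval_continuous g).comp KMeasure.continuous_val

/-- A measure outside a closed ideal is separated from it by a `K`-averaged function. -/
theorem exists_separating_sharp [IsGelfandPair K] {I : Ideal (KMeasure K)}
    (hI : IsClosed (I : Set (KMeasure K))) {μ : KMeasure K} (hμ : μ ∉ I) :
    ∃ g : C(G, ℂ), (∀ ν ∈ I, ν.1 g = 0) ∧ μ.1 g ≠ 0 ∧ sharp K g = g := by
  obtain ⟨g, hg, hne⟩ := exists_separating_of_isInducing (dualPairing K) isInducing_dualPairing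
    (I.restrictScalars ℂ) hI hμ
  refine ⟨sharp K g, fun ν hν => ?_, ?_, ?_⟩
  · rw [ν.sharp_eq]
    exact hg ν hν
  · rw [μ.sharp_eq]
    exact hne
  · rw [sharp_eq K (sharp K g), sharp_eq, leftAvg_rightAvg, leftAvg_leftAvg, rightAvg_rightAvg]

/-! ### Inversion on the compact subgroup -/

/-- Integration over the compact group `K` is invariant under inversion: both sides are the mean
of `h (k⁻¹ * l)` over `(k, l)`, computed in the two orders. -/
theorem integral_haarK_inv (h : C(K, ℂ)) :
    ∫ k, h k⁻¹ ∂haarK K = ∫ k, h k ∂haarK K := by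
  have hF := fubiniK K (h.comp ⟨fun p => p.1⁻¹ * p.2, by fun_prop⟩)
  simp only [ContinuousMap.comp_apply, ContinuousMap.coe_mk] at hF
  have h1 : ∀ k : K, ∫ l, h (k⁻¹ * l) ∂haarK K = ∫ l, h l ∂haarK K := fun k =>
    integral_mul_left_eq_self (μ := haarK K) (fun l => h l) k⁻¹
  have h2 : ∀ l : K, ∫ k, h (k⁻¹ * l) ∂haarK K = ∫ k, h k⁻¹ ∂haarK K := by
    intro l
    have := integral_mul_left_eq_self (μ := haarK K) (fun k : K => h (k⁻¹ * l)) l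
    simpa using this.symm
  simpa [h1, h2] using hF.symm

theorem integral_reflect (f : C(G, ℂ)) (x y : G) :
    ∫ k : K, reflect f (x * k * y) ∂haarK K = ∫ k : K, f (y⁻¹ * k * x⁻¹) ∂haarK K := by
  have := integral_haarK_inv (K := K) (f.comp ⟨fun k : K => y⁻¹ * k * x⁻¹, by fun_prop⟩)
  simpa [reflect_apply, mul_assoc] using this

/-! ### Products with point masses -/

theorem project_pointMass_apply {g : C(G, ℂ)} (hg : sharp K g = g) (y : G) :
    (project K (pointMass y)).1 g = g y := by
  rw [project_apply, hg, pointMass_apply]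

theorem one_apply {g : C(G, ℂ)} (hg : sharp K g = g) : (1 : KMeasure K).1 g = g 1 :=
  project_pointMass_apply hg 1

theorem leftAvg_eq_of_sharp_eq {g : C(G, ℂ)} (hg : sharp K g = g) : leftAvg K g = g := by
  rw [← hg, sharp_eq, ← leftAvg_rightAvg, leftAvg_leftAvg]

theorem rightAvg_eq_of_sharp_eq {g : C(G, ℂ)} (hg : sharp K g = g) : rightAvg K g = g := by
  rw [← hg, sharp_eq, rightAvg_rightAvg]

/-- Pairing `δ_x^# * δ_y^#` with a `K`-averaged function gives its mean over `xKy`. -/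
theorem project_mul_project_apply {g : C(G, ℂ)} (hg : sharp K g = g) (x y : G) :
    (project K (pointMass x) * project K (pointMass y)).1 g =
      ∫ k : K, g (x * k * y) ∂haarK K := by
  set ν := project K (pointMass y)
  have hν : ∀ h, ν.1 h = sharp K h y := fun h => rfl
  have h1 : sharp K (convInner ν.1 g) = convInner ν.1 g := by
    rw [sharp_eq, ← convInner_leftAvg, leftAvg_eq_of_sharp_eq hg]
    ext x
    have hl : ∀ l : K, convInner ν.1 g (x * l) = convInner ν.1 g x := by
      intro l
      rw [convInner_apply, convInner_apply, ← ν.leftAvg_eq, ← ν.leftAvg_eq (translate g x)]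
      congr 1
      ext z
      rw [leftAvg_translate_apply, leftAvg_translate_apply]
      have := integral_mul_left_eq_self (μ := haarK K) (fun k : K => g (x * k * z)) l
      simpa [mul_assoc] using this
    simp [rightAvg_apply, hl]
  rw [KMeasure.coe_mul, conv_apply, project_pointMass_apply h1, convInner_apply, hν, sharp_eq]
  have h2 : rightAvg K (translate g x) = translate g x := by
    conv_rhs => rw [← rightAvg_eq_of_sharp_eq hg]
    ext z
    simp [rightAvg_apply, translate_apply, mul_assoc]
  rw [← leftAvg_rightAvg, h2, leftAvg_translate_apply]

/-! ### The character of a spherical function -/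

/-- If `h` is `K`-spherical, then `μ ↦ ⟨μ, h⟩` is multiplicative. -/
theorem mul_apply_of_spherical {h : C(G, ℂ)}
    (hmul : ∀ x y : G, ∫ k : K, h (x * k * y) ∂haarK K = h x * h y) (μ ν : KMeasure K) :
    (μ * ν).1 h = μ.1 h * ν.1 h := by
  have h1 : convInner ν.1 h = ν.1 h • h := by
    ext x
    have h2 : leftAvg K (translate h x) = h x • h := by
      ext y
      rw [leftAvg_translate_apply, hmul]
      rfl
    rw [convInner_apply, ← ν.leftAvg_eq, h2, map_smul]
    exact mul_comm _ _
  rw [KMeasure.coe_mul, conv_apply, h1, map_smul, smul_eq_mul, mul_comm]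

/-- The character `μ ↦ ⟨μ, h⟩` of `M_c(G//K)` given by a `K`-spherical function `h`. -/
def sphericalCharacter (h : C(G, ℂ)) (hK : IsKInvariant K h) (h1 : h 1 = 1)
    (hmul : ∀ x y : G, ∫ k : K, h (x * k * y) ∂haarK K = h x * h y) : KMeasure K →ₐ[ℂ] ℂ :=
  AlgHom.ofLinearMap ((dualPairing K).flip h) ((one_apply hK.sharp_eq).trans h1)
    (mul_apply_of_spherical hmul)

/-- The kernel of a continuous character is an exponential maximal ideal. -/
theorem isExponentialMaximal_ker [IsGelfandPair K] (χ : KMeasure K →ₐ[ℂ] ℂ)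
    (hχ : Continuous χ) : IsExponentialMaximal (RingHom.ker χ) := by
  have hsurj : Function.Surjective χ := fun z => ⟨algebraMap ℂ (KMeasure K) z, by simp⟩
  refine ⟨RingHom.ker_isMaximal_of_surjective χ hsurj,
    Ideal.quotientKerAlgEquivOfSurjective hsurj, ?_, ?_⟩
  · exact continuous_quot_lift _ hχ
  · have h1 : ∀ z : ℂ, (Ideal.quotientKerAlgEquivOfSurjective hsurj).symm z =
        Ideal.Quotient.mk (RingHom.ker χ) (z • 1) := by
      intro z
      rw [AlgEquiv.symm_apply_eq]
      change z = χ (z • 1)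
      simp
    have h2 : Continuous fun z : ℂ => (z • 1 : KMeasure K) :=
      continuous_induced_rng.2 (WeakDual.continuous_of_continuous_eval fun g =>
        continuous_id.mul continuous_const)
    exact (continuous_quot_mk.comp h2).congr fun z => (h1 z).symm

/-! ### Functions annihilating `M_f` -/

theorem isClosed_sphericalIdeal [IsGelfandPair K] (f : C(G, ℂ)) :
    IsClosed (sphericalIdeal K f : Set (KMeasure K)) :=
  isClosed_closure

theorem sphericalDifference_mem [IsGelfandPair K] (f : C(G, ℂ)) (y : G) :
    sphericalDifference K f y ∈ sphericalIdeal K f :=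
  subset_closure (Ideal.subset_span ⟨y, rfl⟩)

/-- If `g` annihilates `M_f`, then multiplication by `δ_{y⁻¹}^#` acts on the pairing with `g` as
the scalar `f y`. -/
theorem mul_project_apply_of_annihilates [IsGelfandPair K] {f g : C(G, ℂ)}
    (hg : ∀ ν ∈ sphericalIdeal K f, ν.1 g = 0) (μ : KMeasure K) (y : G) :
    (μ * project K (pointMass y⁻¹)).1 g = f y * μ.1 g := by
  have h := hg _ ((sphericalIdeal K f).mul_mem_left μ (sphericalDifference_mem f y))
  rw [sphericalDifference, ← KMeasure.one_def, mul_sub, mul_smul_comm, mul_one] at h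
  exact sub_eq_zero.1 h

/-- A `K`-averaged function annihilating `M_f` is a multiple of the reflection of `f`. -/
theorem eq_smul_reflect_of_annihilates [IsGelfandPair K] {f g : C(G, ℂ)}
    (hg : ∀ ν ∈ sphericalIdeal K f, ν.1 g = 0) (hgs : sharp K g = g) :
    g = g 1 • reflect f := by
  ext x
  have h := mul_project_apply_of_annihilates hg 1 x⁻¹
  rw [one_mul, project_pointMass_apply hgs, one_apply hgs, inv_inv] at h
  rw [h, mul_comm]
  rfl

/-- If `M_f` is proper, then `f` is `K`-spherical. -/
theorem spherical_of_sphericalIdeal_ne_top [IsGelfandPair K] {f : C(G, ℂ)}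
    (h : sphericalIdeal K f ≠ ⊤) :
    f 1 = 1 ∧ ∀ x y : G, ∫ k : K, f (x * k * y) ∂haarK K = f x * f y := by
  obtain ⟨g, hg, hne, hgs⟩ := exists_separating_sharp (isClosed_sphericalIdeal f)
    fun h1 => h ((Ideal.eq_top_iff_one _).2 h1)
  rw [one_apply hgs] at hne
  obtain ⟨c, hc⟩ : ∃ c, g 1 = c := ⟨_, rfl⟩
  have hgf : ∀ x, g x = c * f x⁻¹ := fun x => by
    rw [← hc]
    exact DFunLike.congr_fun (eq_smul_reflect_of_annihilates hg hgs) x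
  rw [hc] at hne
  refine ⟨?_, fun x y => ?_⟩
  · have := hgf 1
    rw [inv_one, hc] at this
    exact mul_left_cancel₀ hne (by rw [← this, mul_one])
  · have h2 := mul_project_apply_of_annihilates hg (project K (pointMass y⁻¹)) x
    rw [project_mul_project_apply hgs, project_pointMass_apply hgs] at h2
    have h3 := integral_reflect (K := K) f y⁻¹ x⁻¹
    simp only [inv_inv] at h3
    simp only [hgf, ← reflect_apply f (_ * _), inv_inv] at h2
    rw [integral_const_mul, h3] at h2
    refine mul_left_cancel₀ hne (h2.trans ?_)
    ring

/-- For a `K`-spherical function `f`, the ideal `M_f` is the kernel of a character. -/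
theorem sphericalIdeal_eq_ker [IsGelfandPair K] {f : C(G, ℂ)} (hf : IsKInvariant K f)
    (χ : KMeasure K →ₐ[ℂ] ℂ) (hχ : ∀ μ : KMeasure K, χ μ = μ.1 (reflect f)) :
    sphericalIdeal K f = RingHom.ker χ := by
  have hcont : Continuous χ :=
    (continuous_dualPairing_flip (K := K) (reflect f)).congr fun μ => (hχ μ).symm
  apply le_antisymm
  · refine closure_minimal ?_ (isClosed_singleton.preimage hcont)
    refine (Ideal.span_le (I := RingHom.ker χ)).2 ?_
    rintro _ ⟨y, rfl⟩
    change χ (sphericalDifference K f y) = 0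
    rw [sphericalDifference, ← KMeasure.one_def, map_sub, map_smul, map_one, hχ,
      project_pointMass_apply hf.reflect.sharp_eq, reflect_apply, inv_inv, smul_eq_mul, mul_one,
      sub_self]
  · intro μ hμ
    by_contra hnot
    obtain ⟨g, hg, hne, hgs⟩ := exists_separating_sharp (isClosed_sphericalIdeal f) hnot
    apply hne
    rw [eq_smul_reflect_of_annihilates hg hgs, map_smul, ← hχ, RingHom.mem_ker.1 hμ, smul_zero]

/-- For a `K`-spherical function `f`, the ideal `M_f` is exponential. -/
theorem isExponentialMaximal_sphericalIdeal [IsGelfandPair K] {f : C(G, ℂ)}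
    (hf : IsKInvariant K f) (h1 : f 1 = 1)
    (hmul : ∀ x y : G, ∫ k : K, f (x * k * y) ∂haarK K = f x * f y) :
    IsExponentialMaximal (sphericalIdeal K f) := by
  have hmul' : ∀ x y : G, ∫ k : K, reflect f (x * k * y) ∂haarK K =
      reflect f x * reflect f y := fun x y => by
    rw [integral_reflect, hmul, mul_comm]
    rfl
  rw [sphericalIdeal_eq_ker hf
    (sphericalCharacter (reflect f) hf.reflect (by rw [reflect_apply, inv_one, h1]) hmul')
    fun μ => rfl]
  exact isExponentialMaximal_ker _ (continuous_dualPairing_flip (reflect f))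

end Spherical

end KSpherical

end

theorem mainTheorem4 {G : Type*} [Group G] [TopologicalSpace G] [IsTopologicalGroup G]
    [LocallyCompactSpace G] [T2Space G] [MeasurableSpace G] [BorelSpace G]
    (K : Subgroup G) [CompactSpace K] [KSpherical.IsGelfandPair K]
    (f : C(G, ℂ)) (hf : KSpherical.IsKInvariant K f) :
    (KSpherical.sphericalIdeal K f ≠ ⊤ ↔
      f 1 = 1 ∧ ∀ x y : G, ∫ k : K, f (x * k * y) ∂(KSpherical.haarK K) = f x * f y) ∧
    (KSpherical.sphericalIdeal K f ≠ ⊤ →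
      (KSpherical.sphericalIdeal K f).IsMaximal ∧
      Nonempty ((KSpherical.KMeasure K ⧸ KSpherical.sphericalIdeal K f) ≃ₐ[ℂ] ℂ) ∧
      KSpherical.IsExponentialMaximal (KSpherical.sphericalIdeal K f)) := by
  refine ⟨⟨KSpherical.spherical_of_sphericalIdeal_ne_top, fun h => ?_⟩, fun h => ?_⟩
  · exact (KSpherical.isExponentialMaximal_sphericalIdeal hf h.1 h.2).isMaximal.ne_top
  · obtain ⟨h1, hmul⟩ := KSpherical.spherical_of_sphericalIdeal_ne_top h
    have hexp := KSpherical.isExponentialMaximal_sphericalIdeal hf h1 hmul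
    obtain ⟨e, -⟩ := hexp.exists_equiv
    exact ⟨hexp.isMaximal, ⟨e⟩, hexp⟩
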